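/- Let $k$ be a field. For a finite group $G$ and a field extension $F/k$, a $G$-torsor over $F$ is the same as a Galois $G$-algebra over $F$: a nonzero commutative $F$-algebra $A$ with an action of $G$ by $F$-algebra automorphisms such that $A\otimes_F A\to\prod_{g\in G}A$, $a\otimes b\mapsto (a\,g(b))_g$, is bijective. For a prime $l$, let $\operatorname{ed}_k(A,l)$ be the minimum of $\operatorname{trdeg}_k(K)$ over all finite field extensions $E/F$ with $l\nmid [E:F]$ and all intermediate fields $k\subseteq K\subseteq E$ such that $E\otimes_F A\cong E\otimes_K B$ as $G$-algebras over $E$ for some Galois $G$-algebra $B$ over $K$. The essential $l$-dimension $\operatorname{ed}_k(G,l)$ is the supremum of $\operatorname{ed}_k(A,l)$ over all field extensions $F/k$ and all Galois $G$-algebras $A$ over $F$. Theorem. Let $p$ be a prime, $q=p^r$ with $r\ge 1$, and let $l$ be a prime with $l\neq 2$ and $l\neq p$. Let $k$ be a field with $\operatorname{char} k\neq l$, let $n\ge 0$ be an integer, and let $d$ be the smallest positive integer such that $l\mid q^d-1$. Let $Sp(2n,q)$ be the symplectic group of $2n\times 2n$ matrices over $\mathbb{F}_q$ and $PSp(2n,q)$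 its quotient by its centre. Then $$\operatorname{ed}_k(PSp(2n,q),l)=\operatorname{ed}_k(Sp(2n,q),l)=\begin{cases}\operatorname{ed}_k(GL_{2n}(\mathbb{F}_q),l), & d \text{ even},\\ \operatorname{ed}_k(GL_n(\mathbb{F}_q),l), & d\text{ odd}.\end{cases}$$ -/

import Mathlib

open scoped TensorProduct

universe u v

/-- The `F`-algebra map `A ⊗ A → ∏_{g ∈ G} A`, `a ⊗ b ↦ (a * g(b))_g`, attached to an action of `G`
on the commutative `F`-algebra `A`. On spectra it is the map `G × X → X ×_F X`,
`(g, x) ↦ (x, x g)`, for `X = Spec A` with the induced right action. -/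
noncomputable def galoisMap {G : Type v} [Group G] {F : Type u} [Field F] {A : Type u} [CommRing A]
    [Algebra F A] (ρ : G →* (A ≃ₐ[F] A)) : A ⊗[F] A →ₐ[F] (G → A) :=
  Algebra.TensorProduct.productMap
    (AlgHom.pi (fun _ : G => AlgHom.id F A))
    (AlgHom.pi (fun g : G => (ρ g : A →ₐ[F] A)))

/-- For a finite group `G`, a `G`-torsor over `Spec F`, given as a Galois `G`-algebra over `F`:
a nonzero commutative `F`-algebra with an action of `G` by `F`-algebra automorphisms such that
`A ⊗ A → ∏_{g ∈ G} A` is bijective. (Such an `A` is automatically étale of dimension `|G|`.) -/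
structure GaloisAlg (G : Type v) [Group G] (F : Type u) [Field F] where
  carrier : Type u
  [commRing : CommRing carrier]
  [algebra : Algebra F carrier]
  act : G →* (carrier ≃ₐ[F] carrier)
  nontrivial : Nontrivial carrier
  bijective : Function.Bijective (galoisMap act)

attribute [instance] GaloisAlg.commRing GaloisAlg.algebra

/-- The action of `g : G` on the base change `E ⊗_F A` of a Galois `G`-algebra `A` over `F`. -/
noncomputable def GaloisAlg.baseChangeAct {G : Type v} [Group G] {F : Type u} [Field F]
    (A : GaloisAlg G F) (E : Type u) [Field E] [Algebra F E] (g : G) :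
    E ⊗[F] A.carrier ≃ₐ[E] E ⊗[F] A.carrier :=
  Algebra.TensorProduct.congr (AlgEquiv.refl : E ≃ₐ[E] E) (A.act g)

/-- Galois `G`-algebras `A` over `F` and `B` over `K` become isomorphic, as `G`-algebras,
over the common extension field `E`. -/
def GaloisAlg.IsoOver {G : Type v} [Group G] {F K : Type u} [Field F] [Field K]
    (A : GaloisAlg G F) (B : GaloisAlg G K) (E : Type u) [Field E] [Algebra F E] [Algebra K E] :
    Prop :=
  ∃ e : E ⊗[F] A.carrier ≃ₐ[E] E ⊗[K] B.carrier,
    ∀ (g : G) (x : E ⊗[F] A.carrier),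
      e (A.baseChangeAct E g x) = B.baseChangeAct E g (e x)

/-- The essential `l`-dimension over `k` of a `G`-torsor `A` over `F`: the minimum of
`trdeg_k K` over all finite extensions `E / F` of degree prime to `l` and all intermediate fields
`k ⊆ K ⊆ E` such that `A` becomes, over `E`, isomorphic to a torsor coming from `K`. -/
noncomputable def GaloisAlg.essDimAt (k : Type u) [Field k] {G : Type v} [Group G]
    {F : Type u} [Field F] [Algebra k F] (A : GaloisAlg G F) (l : ℕ) : ℕ∞ :=
  sInf {m : ℕ∞ | ∃ (E : Type u) (_ : Field E) (_ : Algebra k E) (_ : Algebra F E)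
    (_ : IsScalarTower k F E) (_ : FiniteDimensional F E), ¬ l ∣ Module.finrank F E ∧
      ∃ (K : IntermediateField k E) (B : GaloisAlg G K),
        A.IsoOver B E ∧ m = Cardinal.toENat (Algebra.trdeg k K)}

/-- The essential `l`-dimension `ed_k(G, l)` of a finite group `G` over the field `k`: the
supremum of the essential `l`-dimensions of all `G`-torsors over all field extensions `F / k`. -/
noncomputable def essDimAt (k : Type u) [Field k] (G : Type v) [Group G] (l : ℕ) : ℕ∞ :=
  sSup {m : ℕ∞ | ∃ (F : Type u) (_ : Field F) (_ : Algebra k F) (A : GaloisAlg G F),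
    m = A.essDimAt k l}

/-- The symplectic group `Sp(2n, K)`. -/
abbrev Sp (n : ℕ) (K : Type v) [Field K] : Type v :=
  Matrix.symplecticGroup (Fin n) K

/-- The projective symplectic group `PSp(2n, K)`, the quotient of `Sp(2n, K)` by its centre. -/
abbrev PSp (n : ℕ) (K : Type v) [Field K] : Type v :=
  Sp n K ⧸ Subgroup.center (Sp n K)

/-!
A `G`-torsor `A` is handled through a dual system `∑ i, x i * g (y i) = δ_{g, 1}`, which any
equivariant homomorphism preserves: so torsors related by such a homomorphism are isomorphic after
extension of scalars.

Let `H` be a subgroup of `G`. If the `G`-torsor induced from an `H`-torsor over `F` descends over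
`E` to `B` over `K`, then the invariants `B ^ H` map to `E`, and base change along this map makes
the `H`-torsor descend to an algebraic extension of `K` inside `E`; hence `ed_k(H, l) ≤ ed_k(G, l)`.
Conversely, let `l` be prime to `[G : H]`. Then `A ^ H` has dimension `[G : H]` over `F`, so some
residue field `F'` of it has degree prime to `l`; over `F'` the torsor `A` is induced from `H`, and
therefore `ed_k(G, l) ≤ ed_k(H, l)`.

Thus `ed_k(·, l)` depends only on a Sylow `l`-subgroup, which disposes of the centre of
`Sp(2n, q)`, as its elements satisfy `z ^ 2 = 1`. Counting hyperbolic bases yields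
`|Sp(2n, q)| = q ^ n² * ∏ i ≤ n, (q ^ 2i - 1)`, so the index of `Sp(2n, q)` in `GL_{2n}` is a power
of `q` times `∏ i < n, (q ^ (2i + 1) - 1)`, prime to `l` when `d` is even, while that of the Levi
subgroup `GL_n` in `Sp(2n, q)` is a power of `q` times `∏ i ≤ n, (q ^ i + 1)`, prime to `l` when `d`
is odd.
-/

section GaloisAction

variable {G : Type*} [Group G] {F : Type*} [CommRing F] {A : Type*} [CommRing A] [Algebra F A]
  {ρ : G →* (A ≃ₐ[F] A)}

open Classical in
/-- Two families of elements of `A` are dual for an action of `G` if `∑ i, x i * g (y i)` is `1`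
for `g = 1` and `0` for all other `g`. For finite `G` this is the Chase–Harrison–Rosenberg form of
the Galois condition on `A`, and it makes `x` and `y` dual for the trace form. -/
def IsDualSystem (ρ : G →* (A ≃ₐ[F] A)) {ι : Type*} [Fintype ι] (x y : ι → A) : Prop :=
  ∀ g, ∑ i, x i * ρ g (y i) = if g = 1 then 1 else 0

/-- The Galois extensions of commutative rings with group `G`, in the sense of
Chase–Harrison–Rosenberg: `F` is the ring of invariants of `A`, and a dual system exists. It is
indexed by `Fin m` only to keep universes out of the definition. -/
structure IsGaloisAction (ρ : G →* (A ≃ₐ[F] A)) : Prop where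
  injective : Function.Injective (algebraMap F A)
  fixed : ∀ a, (∀ g, ρ g a = a) → ∃ c, algebraMap F A c = a
  dual : ∃ (m : ℕ) (x y : Fin m → A), IsDualSystem ρ x y

namespace IsDualSystem

variable {ι : Type*} [Fintype ι] {x y : ι → A}

theorem exists_fin (h : IsDualSystem ρ x y) :
    ∃ (m : ℕ) (x y : Fin m → A), IsDualSystem ρ x y := by
  let e := (Fintype.equivFin ι).symm
  exact ⟨_, x ∘ e, y ∘ e, fun g => (e.sum_comp fun i => x i * ρ g (y i)).trans (h g)⟩

open Classical in
theorem sum_apply_mul_apply (h : IsDualSystem ρ x y) (g g' : G) :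
    ∑ i, ρ g (x i) * ρ g' (y i) = if g = g' then 1 else 0 := by
  have hi (i) : ρ g (x i) * ρ g' (y i) = ρ g (x i * ρ (g⁻¹ * g') (y i)) := by
    rw [map_mul (ρ g), ← AlgEquiv.mul_apply, ← map_mul, mul_inv_cancel_left]
  simp only [hi, ← map_sum, h (g⁻¹ * g'), inv_mul_eq_one, apply_ite (ρ g), map_one, map_zero]

theorem comp {H : Type*} [Group H] {i : H →* G} (hi : Function.Injective i)
    (h : IsDualSystem ρ x y) : IsDualSystem (ρ.comp i) x y := fun g => by
  classical exact (h (i g)).trans (if_congr (map_eq_one_iff i hi) rfl rfl)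

theorem sum_sum_apply_mul [Fintype G] (h : IsDualSystem ρ x y) (a : A) :
    ∑ i, (∑ g, ρ g (a * x i)) * y i = a := by
  classical
  have hg (g) : ∑ i, ρ g (a * x i) * y i = if g = 1 then a else 0 := by
    have := h.sum_apply_mul_apply g 1
    simp only [map_one, AlgEquiv.one_apply] at this
    simp only [map_mul, mul_assoc, ← Finset.mul_sum, this]
    split_ifs with h1 <;> simp [h1]
  simp only [Finset.sum_mul]
  rw [Finset.sum_comm, Finset.sum_congr rfl fun g _ => hg g]
  simp

end IsDualSystem

theorem apply_sum_apply [Fintype G] (ρ : G →* (A ≃ₐ[F] A)) (a : A) (g : G) :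
    ρ g (∑ g', ρ g' a) = ∑ g', ρ g' a := by
  simp only [map_sum, ← AlgEquiv.mul_apply, ← map_mul]
  exact Equiv.sum_comp (Equiv.mulLeft g) fun g' => ρ g' a

namespace IsGaloisAction

section Trace

variable [Fintype G]

/-- The trace of a Galois extension, `a ↦ ∑ g, g a` as an element of the ring of invariants. -/
noncomputable def trace (h : IsGaloisAction ρ) : A →ₗ[F] F :=
  (LinearEquiv.ofInjective (Algebra.linearMap F A) h.injective).symm ∘ₗ
    (∑ g, (ρ g).toLinearMap).codRestrict (LinearMap.range (Algebra.linearMap F A)) fun a =>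
      LinearMap.mem_range.2 (h.fixed _ fun g => by simpa using apply_sum_apply ρ a g)

theorem algebraMap_trace (h : IsGaloisAction ρ) (a : A) :
    algebraMap F A (h.trace a) = ∑ g, ρ g a :=
  (LinearEquiv.ofInjective_symm_apply (f := Algebra.linearMap F A) (h := h.injective) _).trans
    (by simp)

theorem sum_trace_smul (h : IsGaloisAction ρ) {ι : Type*} [Fintype ι] {x y : ι → A}
    (hxy : IsDualSystem ρ x y) (a : A) : ∑ i, h.trace (a * x i) • y i = a := by
  simpa only [Algebra.smul_def, h.algebraMap_trace] using hxy.sum_sum_apply_mul a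

end Trace

variable [Finite G]

theorem finite (h : IsGaloisAction ρ) : Module.Finite F A := by
  have := Fintype.ofFinite G
  obtain ⟨m, x, y, hxy⟩ := h.dual
  exact .of_surjective (Fintype.linearCombination F y) fun a =>
    ⟨fun i => h.trace (a * x i), h.sum_trace_smul hxy a⟩

theorem isReduced [IsReduced F] (h : IsGaloisAction ρ) : IsReduced A := by
  have := Fintype.ofFinite G
  obtain ⟨m, x, y, hxy⟩ := h.dual
  refine ⟨fun a ha => ?_⟩
  have htr (i) : h.trace (a * x i) = 0 := by
    rw [← isNilpotent_iff_eq_zero, ← IsNilpotent.map_iff h.injective, h.algebraMap_trace]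
    exact isNilpotent_sum fun g _ => ((Commute.all a _).isNilpotent_mul_right ha).map (ρ g)
  simpa [htr] using (h.sum_trace_smul hxy a).symm

end IsGaloisAction

/-- By the dual system, `A = (trace A) A`; since `A` is a finite faithful `F`-module, Nakayama's
lemma makes the trace ideal the unit ideal. -/
theorem IsGaloisAction.exists_trace_eq_one [Fintype G] (h : IsGaloisAction ρ) :
    ∃ a, h.trace a = 1 := by
  obtain ⟨m, x, y, hxy⟩ := h.dual
  have hle : (⊤ : Submodule F A) ≤ (LinearMap.range h.trace : Ideal F) • ⊤ := fun a _ => by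
    rw [← h.sum_trace_smul hxy a]
    exact sum_mem fun i _ => Submodule.smul_mem_smul ⟨_, rfl⟩ trivial
  obtain ⟨r, hr, hr0⟩ := Submodule.exists_sub_one_mem_and_smul_eq_zero_of_fg_of_le_smul
    _ _ h.finite.fg_top hle
  have : r = 0 := h.injective <| by
    simpa [Algebra.algebraMap_eq_smul_one] using hr0 1 trivial
  rw [this, zero_sub] at hr
  exact neg_mem_iff.mp hr

end GaloisAction

section TorsorHom

variable {G : Type*} [Group G]

/-- An equivariant ring homomorphism `B → C` over the structure map `R → E` of the scalars. If both
actions are Galois, it is a morphism from the torsor `Spec C` to the torsor `Spec B`. -/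
structure IsTorsorHom {R E B C : Type*} [CommRing R] [CommRing E] [Algebra R E] [CommRing B]
    [Algebra R B] [CommRing C] [Algebra E C] (ρ : G →* (B ≃ₐ[R] B)) (σ : G →* (C ≃ₐ[E] C))
    (f : B →+* C) : Prop where
  map_algebraMap : ∀ c, f (algebraMap R B c) = algebraMap E C (algebraMap R E c)
  map_act : ∀ g b, f (ρ g b) = σ g (f b)

/-- The action on `E ⊗[F] A` through the second factor. -/
noncomputable def baseChangeHom {F A : Type*} [CommRing F] [CommRing A] [Algebra F A]
    (ρ : G →* (A ≃ₐ[F] A)) (E : Type*) [CommRing E] [Algebra F E] :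
    G →* (E ⊗[F] A ≃ₐ[E] E ⊗[F] A) where
  toFun g := Algebra.TensorProduct.congr (AlgEquiv.refl : E ≃ₐ[E] E) (ρ g)
  map_one' := by ext x; induction x <;> simp_all
  map_mul' g h := by ext x; induction x <;> simp_all

theorem baseChangeHom_tmul {F A : Type*} [CommRing F] [CommRing A] [Algebra F A]
    (ρ : G →* (A ≃ₐ[F] A)) (E : Type*) [CommRing E] [Algebra F E] (g : G) (e : E) (a : A) :
    baseChangeHom ρ E g (e ⊗ₜ a) = e ⊗ₜ ρ g a := rfl

variable {R S E B C D : Type*} [CommRing R] [CommRing S] [CommRing E] [Algebra R S] [Algebra R E]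
  [CommRing B] [Algebra R B] [CommRing C] [Algebra E C] [CommRing D] [Algebra S D]
  {ρ : G →* (B ≃ₐ[R] B)} {σ : G →* (C ≃ₐ[E] C)} {τ : G →* (D ≃ₐ[S] D)} {f : B →+* C}

theorem isTorsorHom_includeRight (ρ : G →* (B ≃ₐ[R] B)) (E : Type*) [CommRing E] [Algebra R E] :
    IsTorsorHom ρ (baseChangeHom ρ E)
      (Algebra.TensorProduct.includeRight : B →ₐ[R] E ⊗[R] B).toRingHom where
  map_algebraMap c := (Algebra.TensorProduct.tmul_one_eq_one_tmul c).symm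
  map_act _ _ := rfl

theorem isTorsorHom_rTensor (ρ : G →* (B ≃ₐ[R] B)) [Algebra S E] [IsScalarTower R S E] :
    IsTorsorHom (baseChangeHom ρ S) (baseChangeHom ρ E)
      (Algebra.TensorProduct.map (IsScalarTower.toAlgHom R S E) (AlgHom.id R B)).toRingHom where
  map_algebraMap c := by simp
  map_act g b := by
    induction b with
    | zero => simp
    | tmul s b => simp [baseChangeHom_tmul]
    | add b b' hb hb' => simp only [map_add, hb, hb']

theorem isTorsorHom_of_algEquiv {B' : Type*} [CommRing B'] [Algebra R B'] {σ : G →* (B' ≃ₐ[R] B')}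
    (e : B ≃ₐ[R] B') (he : ∀ g b, e (ρ g b) = σ g (e b)) :
    IsTorsorHom ρ σ (e : B →+* B') :=
  ⟨e.commutes, he⟩

namespace IsTorsorHom

theorem comp [Algebra S E] [IsScalarTower R S E] {f : B →+* D} {f' : D →+* C}
    (hf' : IsTorsorHom τ σ f') (hf : IsTorsorHom ρ τ f) : IsTorsorHom ρ σ (f'.comp f) where
  map_algebraMap c := by
    simp [hf.map_algebraMap, hf'.map_algebraMap, ← IsScalarTower.algebraMap_apply]
  map_act g b := by simp [hf.map_act, hf'.map_act]

theorem restrict (hf : IsTorsorHom ρ σ f) {H : Type*} [Group H] (i : H →* G) :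
    IsTorsorHom (ρ.comp i) (σ.comp i) f :=
  ⟨hf.map_algebraMap, fun h => hf.map_act (i h)⟩

theorem map_isDualSystem (hf : IsTorsorHom ρ σ f) {ι : Type*} [Fintype ι] {x y : ι → B}
    (hxy : IsDualSystem ρ x y) : IsDualSystem σ (f ∘ x) (f ∘ y) := fun g => by
  simpa only [Function.comp_apply, map_sum, map_mul, hf.map_act, apply_ite f, map_one, map_zero]
    using congrArg f (hxy g)

theorem map_trace [Fintype G] (hf : IsTorsorHom ρ σ f) (hρ : IsGaloisAction ρ)
    (hσ : IsGaloisAction σ) (b : B) : hσ.trace (f b) = algebraMap R E (hρ.trace b) :=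
  hσ.injective <| by
    simp only [← hf.map_algebraMap, IsGaloisAction.algebraMap_trace, map_sum, hf.map_act]

/-- The `E`-linear extension `E ⊗[R] B → C` of a homomorphism `B → C` over `R → E`. -/
noncomputable def lift (hf : IsTorsorHom ρ σ f) : E ⊗[R] B →ₐ[E] C :=
  letI : Algebra R C := ((algebraMap E C).comp (algebraMap R E)).toAlgebra
  haveI : IsScalarTower R E C := IsScalarTower.of_algebraMap_eq fun _ => rfl
  Algebra.TensorProduct.lift (Algebra.ofId E C) { f with commutes' := hf.map_algebraMap }
    fun _ _ => Commute.all _ _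

theorem lift_tmul (hf : IsTorsorHom ρ σ f) (e : E) (b : B) :
    hf.lift (e ⊗ₜ b) = algebraMap E C e * f b := rfl

theorem isTorsorHom_lift (hf : IsTorsorHom ρ σ f) :
    IsTorsorHom (baseChangeHom ρ E) σ (hf.lift : E ⊗[R] B →+* C) where
  map_algebraMap := hf.lift.commutes
  map_act g t := by
    induction t with
    | zero => simp
    | tmul e b => simp [baseChangeHom_tmul, lift_tmul, hf.map_act]
    | add t t' ht ht' => simp only [map_add, ht, ht']

theorem exists_baseChange (hf : IsTorsorHom ρ σ f) (S : Type*) [CommRing S] [Algebra R S]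
    [Algebra S E] [IsScalarTower R S E] :
    ∃ f' : S ⊗[R] B →+* C, IsTorsorHom (baseChangeHom ρ S) σ f' :=
  ⟨_, hf.isTorsorHom_lift.comp (isTorsorHom_rTensor ρ)⟩

theorem bijective_lift [Finite G] (hf : IsTorsorHom ρ σ f) (hρ : IsGaloisAction ρ)
    (hσ : IsGaloisAction σ) : Function.Bijective hf.lift := by
  have := Fintype.ofFinite G
  obtain ⟨m, x, y, hxy⟩ := hρ.dual
  let inv (c : C) : E ⊗[R] B := ∑ i, hσ.trace (c * f (x i)) ⊗ₜ[R] y i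
  have hleft : Function.LeftInverse inv hf.lift := fun t => by
    induction t with
    | zero => simp [inv]
    | tmul e b =>
      have hi (i) : hσ.trace (hf.lift (e ⊗ₜ b) * f (x i)) ⊗ₜ[R] y i =
          e ⊗ₜ[R] (hρ.trace (b * x i) • y i) := by
        rw [lift_tmul, mul_assoc, ← map_mul, ← Algebra.smul_def, map_smul, hf.map_trace hρ hσ,
          smul_eq_mul, mul_comm, ← Algebra.smul_def, TensorProduct.smul_tmul]
      simp only [inv, hi, ← TensorProduct.tmul_sum, hρ.sum_trace_smul hxy]
    | add t t' ht ht' =>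
      simp only [inv] at ht ht' ⊢
      simp only [map_add, add_mul, TensorProduct.add_tmul, Finset.sum_add_distrib, ht, ht']
  have hright : Function.RightInverse inv hf.lift := fun c => by
    simpa only [inv, map_sum, lift_tmul, ← Algebra.smul_def, Function.comp_apply]
      using hσ.sum_trace_smul (hf.map_isDualSystem hxy) c
  exact Function.bijective_iff_has_inverse.2 ⟨inv, hleft, hright⟩

end IsTorsorHom

namespace IsGaloisAction

theorem of_algEquiv {B' : Type*} [CommRing B'] [Algebra R B'] {σ : G →* (B' ≃ₐ[R] B')}
    (hρ : IsGaloisAction ρ) (e : B ≃ₐ[R] B') (he : ∀ g b, e (ρ g b) = σ g (e b)) :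
    IsGaloisAction σ where
  injective := by
    rw [← e.toAlgHom.comp_algebraMap]
    exact e.injective.comp hρ.injective
  fixed b hb := by
    obtain ⟨c, hc⟩ := hρ.fixed (e.symm b) fun g => e.injective (by simp [he, hb])
    exact ⟨c, by rw [← e.commutes, hc, e.apply_symm_apply]⟩
  dual := by
    obtain ⟨m, x, y, hxy⟩ := hρ.dual
    exact ⟨m, _, _, (isTorsorHom_of_algEquiv e he).map_isDualSystem hxy⟩

theorem baseChange [Finite G] (hρ : IsGaloisAction ρ) (E : Type*) [CommRing E] [Algebra R E] :
    IsGaloisAction (baseChangeHom ρ E) := by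
  have := Fintype.ofFinite G
  obtain ⟨a, ha⟩ := hρ.exists_trace_eq_one
  have ha' : ∑ g, ρ g a = 1 := by rw [← hρ.algebraMap_trace, ha, map_one]
  let tr : E ⊗[R] B →ₗ[E] E :=
    (TensorProduct.AlgebraTensorModule.rid R E E).toLinearMap ∘ₗ hρ.trace.baseChange E
  have htr (t) : algebraMap E (E ⊗[R] B) (tr t) = ∑ g, baseChangeHom ρ E g t := by
    induction t with
    | zero => simp
    | tmul e b =>
      simp [tr, baseChangeHom_tmul, ← TensorProduct.tmul_sum, ← hρ.algebraMap_trace,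
        Algebra.algebraMap_eq_smul_one (hρ.trace b), TensorProduct.smul_tmul']
    | add t t' ht ht' => simp only [map_add, ht, ht', Finset.sum_add_distrib]
  refine ⟨Function.LeftInverse.injective (g := fun t => tr (t * 1 ⊗ₜ a)) fun e => ?_,
    fun t ht => ⟨tr (t * 1 ⊗ₜ a), ?_⟩, ?_⟩
  · simp [tr, ha]
  · simp only [htr, map_mul, ht, ← Finset.mul_sum, baseChangeHom_tmul,
      ← TensorProduct.tmul_sum, ha', ← Algebra.TensorProduct.one_def, mul_one]
  · obtain ⟨m, x, y, hxy⟩ := hρ.dual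
    exact ⟨m, _, _, (isTorsorHom_includeRight ρ E).map_isDualSystem hxy⟩

end IsGaloisAction

end TorsorHom

section Translation

variable {G : Type*} [Group G]

/-- The action of `G` on functions `G → A` by right translation: the trivial `G`-torsor. -/
def translationAct (G A : Type*) [Group G] [CommRing A] : G →* ((G → A) ≃ₐ[A] (G → A)) where
  toFun g := AlgEquiv.piCongrLeft' A (fun _ => A) (Equiv.mulRight g).symm
  map_one' := by ext w x; exact congrArg w (mul_one x)
  map_mul' g g' := by ext w x; exact congrArg w (mul_assoc x g g').symm

theorem translationAct_apply {A : Type*} [CommRing A] (g : G) (w : G → A) (x : G) :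
    translationAct G A g w x = w (x * g) := rfl

theorem isTorsorHom_translationAct {F A : Type*} [CommRing F] [CommRing A] [Algebra F A]
    (ρ : G →* (A ≃ₐ[F] A)) :
    IsTorsorHom ρ (translationAct G A) (RingHom.pi fun g => (ρ g : A →+* A)) where
  map_algebraMap c := funext fun x => (ρ x).commutes c
  map_act g a := funext fun x => by simp [translationAct_apply]

theorem IsGaloisAction.translation {F A : Type*} [CommRing F] [CommRing A] [Algebra F A]
    {ρ : G →* (A ≃ₐ[F] A)} (h : IsGaloisAction ρ) : IsGaloisAction (translationAct G A) where
  injective a b hab := congrFun hab 1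
  fixed w hw := ⟨w 1, funext fun g => by
    simpa [translationAct_apply] using (congrFun (hw g) 1).symm⟩
  dual := by
    obtain ⟨m, x, y, hxy⟩ := h.dual
    exact ⟨m, _, _, (isTorsorHom_translationAct ρ).map_isDualSystem hxy⟩

end Translation

section GaloisMap

variable {G : Type v} [Group G] {F : Type u} [Field F] {A : Type u} [CommRing A] [Algebra F A]
  {ρ : G →* (A ≃ₐ[F] A)}

theorem galoisMap_tmul (ρ : G →* (A ≃ₐ[F] A)) (a b : A) (g : G) :
    galoisMap ρ (a ⊗ₜ b) g = a * ρ g b := by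
  simp [galoisMap]

/-- The Galois map is the comparison of `A` with the trivial torsor over `A`. -/
theorem IsGaloisAction.bijective_galoisMap [Finite G] (h : IsGaloisAction ρ) :
    Function.Bijective (galoisMap ρ) := by
  have hlift : (galoisMap ρ : A ⊗[F] A → G → A) = (isTorsorHom_translationAct ρ).lift := by
    ext t g
    induction t with
    | zero => simp
    | tmul a b => simp [galoisMap_tmul, IsTorsorHom.lift_tmul, RingHom.pi_apply]
    | add t t' ht ht' => simp only [map_add, Pi.add_apply, ht, ht']
  exact hlift ▸ (isTorsorHom_translationAct ρ).bijective_lift h h.translation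

theorem isGaloisAction_of_bijective [Nontrivial A] (h : Function.Bijective (galoisMap ρ)) :
    IsGaloisAction ρ where
  injective := (algebraMap F A).injective
  fixed a ha := by
    have hcomm : (1 : A) ⊗ₜ[F] a = a ⊗ₜ[F] 1 := h.1 <| by
      ext g
      simp [galoisMap_tmul, ha]
    obtain ⟨φ, hφ⟩ : ∃ φ : A →ₗ[F] F, φ 1 = 1 :=
      (LinearMap.exists_leftInverse_of_injective (Algebra.linearMap F A)
        (LinearMap.ker_eq_bot.2 (algebraMap F A).injective)).imp fun φ hφ => by
          simpa using LinearMap.congr_fun hφ 1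
    refine ⟨φ a, ?_⟩
    simpa [hφ, Algebra.algebraMap_eq_smul_one] using
      (congrArg (TensorProduct.rid F A ∘ φ.lTensor A) hcomm)
  dual := by
    classical
    obtain ⟨t, ht⟩ := h.2 (Pi.single 1 1)
    obtain ⟨m, x, y, rfl⟩ := TensorProduct.exists_sum_tmul_eq t
    refine ⟨m, x, y, fun g => ?_⟩
    simpa only [map_sum, Finset.sum_apply, galoisMap_tmul, Pi.single_apply] using congrFun ht g

end GaloisMap

namespace GaloisAlg

theorem isGaloisAction {G : Type v} [Group G] {F : Type u} [Field F] (A : GaloisAlg G F) :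
    IsGaloisAction A.act :=
  have := A.nontrivial
  isGaloisAction_of_bijective A.bijective

theorem exists_hom_of_isoOver {G : Type v} [Group G] {F K E : Type u} [Field F] [Field K] [Field E]
    [Algebra F E] [Algebra K E] {A : GaloisAlg G F} {B : GaloisAlg G K} (h : A.IsoOver B E) :
    ∃ f : B.carrier →+* E ⊗[F] A.carrier, IsTorsorHom B.act (baseChangeHom A.act E) f := by
  obtain ⟨e, he⟩ := h
  exact ⟨_, (isTorsorHom_of_algEquiv (ρ := baseChangeHom B.act E) e.symm fun g x => by
    rw [AlgEquiv.symm_apply_eq]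
    exact ((he g _).trans (by rw [e.apply_symm_apply]; rfl)).symm).comp
      (isTorsorHom_includeRight B.act E)⟩

theorem isoOver_of_isTorsorHom {G : Type v} [Group G] [Finite G] {F K E : Type u} [Field F]
    [Field K] [Field E] [Algebra F E] [Algebra K E] {A : GaloisAlg G F} {B : GaloisAlg G K}
    {C : Type*} [CommRing C] [Algebra E C] {τ : G →* (C ≃ₐ[E] C)} (hτ : IsGaloisAction τ)
    {f : A.carrier →+* C} (hf : IsTorsorHom A.act τ f)
    {f' : B.carrier →+* C} (hf' : IsTorsorHom B.act τ f') : A.IsoOver B E := by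
  let e := AlgEquiv.ofBijective _ (hf.bijective_lift A.isGaloisAction hτ)
  let e' := AlgEquiv.ofBijective _ (hf'.bijective_lift B.isGaloisAction hτ)
  refine ⟨e.trans e'.symm, fun g x => ?_⟩
  change e'.symm (e (baseChangeHom A.act E g x)) = baseChangeHom B.act E g (e'.symm (e x))
  rw [AlgEquiv.symm_apply_eq]
  refine (hf.isTorsorHom_lift.map_act g x).trans (.trans ?_ (hf'.isTorsorHom_lift.map_act g _).symm)
  exact congrArg (τ g) (e'.apply_symm_apply _).symm

end GaloisAlg

/-- A Galois action over a field may live in any universe, but the algebra is finite, hence small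
enough to be the carrier of a `GaloisAlg`. -/
theorem IsGaloisAction.exists_galoisAlg {G : Type v} [Group G] [Finite G] {F : Type u} [Field F]
    {A : Type*} [CommRing A] [Algebra F A] {ρ : G →* (A ≃ₐ[F] A)} (h : IsGaloisAction ρ) :
    ∃ (B : GaloisAlg G F) (f : B.carrier →+* A), IsTorsorHom B.act ρ f := by
  have := h.finite
  have : Small.{u} A := Module.Finite.small F A
  have : Nontrivial A := h.injective.nontrivial
  let e := (Shrink.algEquiv F A)
  let σ : G →* (Shrink.{u} A ≃ₐ[F] Shrink.{u} A) :=
    (AlgEquiv.autCongr e.symm).toMonoidHom.comp ρ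
  have he (g a) : e.symm (ρ g a) = σ g (e.symm a) := by simp [σ]
  have hσ : IsGaloisAction σ := h.of_algEquiv e.symm he
  exact ⟨⟨Shrink.{u} A, σ, inferInstance, hσ.bijective_galoisMap⟩, _,
    isTorsorHom_of_algEquiv e fun g x => e.symm.injective (by simp [he])⟩

section Induction

variable {G H : Type*} [Group G] [Group H] {i : H →* G} {K B : Type*} [CommRing K] [CommRing B]
  [Algebra K B] {σ : H →* (B ≃ₐ[K] B)}

/-- The algebra induced along `i : H → G` from an algebra with an action of `H`, realised as the
`H`-equivariant functions on `G`. -/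
def inducedSubalgebra (i : H →* G) (σ : H →* (B ≃ₐ[K] B)) : Subalgebra K (G → B) where
  carrier := {w | ∀ h g, w (i h * g) = σ h (w g)}
  mul_mem' hw hw' h g := by simp [hw h g, hw' h g]
  add_mem' hw hw' h g := by simp [hw h g, hw' h g]
  algebraMap_mem' c h g := by simp

/-- The action of `G` on the induced algebra by right translation. -/
def inducedAct (i : H →* G) (σ : H →* (B ≃ₐ[K] B)) :
    G →* (inducedSubalgebra i σ ≃ₐ[K] inducedSubalgebra i σ) where
  toFun x :=
    { toFun w := ⟨fun g => w.1 (g * x), fun h g => by simpa only [mul_assoc] using w.2 h _⟩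
      invFun w := ⟨fun g => w.1 (g * x⁻¹), fun h g => by simpa only [mul_assoc] using w.2 h _⟩
      left_inv w := by ext g; simp
      right_inv w := by ext g; simp
      map_mul' w w' := rfl
      map_add' w w' := rfl
      commutes' c := rfl }
  map_one' := by ext w g; exact congrArg w.1 (mul_one g)
  map_mul' x y := by ext w g; exact congrArg w.1 (mul_assoc g x y).symm

theorem inducedAct_apply (x : G) (w : inducedSubalgebra i σ) (g : G) :
    (inducedAct i σ x w).1 g = w.1 (g * x) := rfl

theorem isTorsorHom_eval_one (i : H →* G) (σ : H →* (B ≃ₐ[K] B)) :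
    IsTorsorHom ((inducedAct i σ).comp i) σ
      ((Pi.evalRingHom (fun _ : G => B) 1).comp (inducedSubalgebra i σ).val.toRingHom) where
  map_algebraMap c := rfl
  map_act h w := by simpa [inducedAct_apply] using w.2 h 1

theorem IsTorsorHom.exists_induced {F A : Type*} [CommRing F] [CommRing A] [Algebra F A]
    [Algebra F K] {ρ : G →* (A ≃ₐ[F] A)} {f : A →+* B} (hf : IsTorsorHom (ρ.comp i) σ f) :
    ∃ f' : A →+* inducedSubalgebra i σ, IsTorsorHom ρ (inducedAct i σ) f' := by
  refine ⟨(RingHom.pi fun g => f.comp (ρ g : A →+* A)).codRestrict (inducedSubalgebra i σ)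
    fun a h g => ?_, fun c => ?_, fun x a => ?_⟩
  · simpa [RingHom.pi_apply] using hf.map_act h (ρ g a)
  · ext g
    exact (congrArg f ((ρ g).commutes c)).trans (hf.map_algebraMap c)
  · ext g
    change f (ρ g (ρ x a)) = f (ρ (g * x) a)
    rw [map_mul, AlgEquiv.mul_apply]

theorem exists_equiv_prod_transversal (hi : Function.Injective i) :
    ∃ (T : Set G) (e : G ≃ H × T), ∀ h g, e (i h * g) = (h * (e g).1, (e g).2) := by
  obtain ⟨T, hT, -⟩ := i.range.exists_isComplement_right 1
  have hbij : Function.Bijective fun p : H × T => i p.1 * p.2 :=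
    hT.comp ((MonoidHom.ofInjective hi).toEquiv.prodCongr (Equiv.refl T)).bijective
  refine ⟨T, (Equiv.ofBijective _ hbij).symm, fun h g => ?_⟩
  obtain ⟨p, rfl⟩ := (Equiv.ofBijective _ hbij).surjective g
  rw [Equiv.symm_apply_eq, Equiv.symm_apply_apply]
  simp [mul_assoc]

theorem IsDualSystem.exists_induced [Finite G] (hi : Function.Injective i) {m : ℕ}
    {x y : Fin m → B} (h : IsDualSystem σ x y) :
    ∃ (m : ℕ) (x y : Fin m → inducedSubalgebra i σ), IsDualSystem (inducedAct i σ) x y := by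
  classical
  obtain ⟨T, e, he⟩ := exists_equiv_prod_transversal hi
  have := Fintype.ofFinite T
  let w (b : B) (t : T) : inducedSubalgebra i σ :=
    ⟨fun z => if (e z).2 = t then σ (e z).1 b else 0, fun h g => by
      simp only [he, map_mul, AlgEquiv.mul_apply]; split_ifs <;> simp⟩
  refine IsDualSystem.exists_fin (ι := T × Fin m) (x := fun j => w (x j.2) j.1)
    (y := fun j => w (y j.2) j.1) fun g => ?_
  ext z
  have hg : g = 1 ↔ (e z).1 = (e (z * g)).1 ∧ (e z).2 = (e (z * g)).2 := by
    rw [← Prod.ext_iff, e.apply_eq_iff_eq, left_eq_mul]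
  have hz (t) : ∑ j, (w (x j) t).1 z * (w (y j) t).1 (z * g) =
      if (e z).2 = t then if g = 1 then 1 else 0 else 0 := by
    by_cases h1 : (e z).2 = t <;> by_cases h2 : (e (z * g)).2 = t <;>
      simp [w, hg, h1, h2, eq_comm (a := t), h.sum_apply_mul_apply]
  simp only [AddSubmonoidClass.coe_finsetSum, Finset.sum_apply, Fintype.sum_prod_type,
    Subalgebra.coe_mul, Pi.mul_apply, inducedAct_apply, hz]
  rw [Finset.sum_ite_eq, if_pos (Finset.mem_univ _)]
  split_ifs <;> rfl

theorem IsGaloisAction.induced [Finite G] (hi : Function.Injective i) (h : IsGaloisAction σ) :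
    IsGaloisAction (inducedAct i σ) where
  injective c c' hc := h.injective (congrFun (congrArg Subtype.val hc) 1)
  fixed w hw := by
    have hconst (g) : w.1 g = w.1 1 := by
      simpa [inducedAct_apply] using congrFun (congrArg Subtype.val (hw g)) 1
    obtain ⟨c, hc⟩ := h.fixed (w.1 1) fun h' => by
      rw [← w.2 h' 1, hconst]
    exact ⟨c, Subtype.ext <| funext fun g => hc.trans (hconst g).symm⟩
  dual := by
    obtain ⟨m, x, y, hxy⟩ := h.dual
    exact hxy.exists_induced hi

end Induction

section FixedSubalgebra

variable {H : Type*} [Group H] {F A : Type*} [CommRing F] [CommRing A] [Algebra F A]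
  {σ : H →* (A ≃ₐ[F] A)}

/-- The ring of invariants of an action by algebra automorphisms. -/
def fixedSubalgebra (σ : H →* (A ≃ₐ[F] A)) : Subalgebra F A :=
  ⨅ h, AlgHom.equalizer (σ h : A →ₐ[F] A) (AlgHom.id F A)

theorem mem_fixedSubalgebra {a : A} : a ∈ fixedSubalgebra σ ↔ ∀ h, σ h a = a := by
  simp [fixedSubalgebra, Algebra.mem_iInf]

/-- An action on `A`, seen as an action over its ring of invariants. -/
def fixedAct (σ : H →* (A ≃ₐ[F] A)) : H →* (A ≃ₐ[fixedSubalgebra σ] A) where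
  toFun h := { σ h with commutes' := fun c => mem_fixedSubalgebra.1 c.2 h }
  map_one' := by ext; simp
  map_mul' h h' := by ext; simp

theorem isTorsorHom_fixedAct (σ : H →* (A ≃ₐ[F] A)) :
    IsTorsorHom σ (fixedAct σ) (RingHom.id A) :=
  ⟨fun _ => rfl, fun _ _ => rfl⟩

theorem IsDualSystem.isGaloisAction_fixedAct {ι : Type*} [Fintype ι] {x y : ι → A}
    (h : IsDualSystem σ x y) : IsGaloisAction (fixedAct σ) where
  injective := Subtype.val_injective
  fixed a ha := ⟨⟨a, mem_fixedSubalgebra.2 ha⟩, rfl⟩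
  dual := IsDualSystem.exists_fin (x := x) (y := y) h

theorem IsGaloisAction.fixedAct_comp {G : Type*} [Group G] {ρ : G →* (A ≃ₐ[F] A)}
    (h : IsGaloisAction ρ) {i : H →* G} (hi : Function.Injective i) :
    IsGaloisAction (fixedAct (ρ.comp i)) := by
  obtain ⟨m, x, y, hxy⟩ := h.dual
  exact (hxy.comp hi).isGaloisAction_fixedAct

theorem IsTorsorHom.exists_fixedSubalgebra {E C : Type*} [CommRing E] [Algebra F E] [CommRing C]
    [Algebra E C] {τ : H →* (C ≃ₐ[E] C)} {f : A →+* C} (hf : IsTorsorHom σ τ f)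
    (hτ : IsGaloisAction τ) :
    ∃ φ : fixedSubalgebra σ →ₐ[F] E, ∀ a : fixedSubalgebra σ, f a = algebraMap E C (φ a) := by
  have hex (a : fixedSubalgebra σ) : ∃ c, algebraMap E C c = f a := hτ.fixed _ fun h => by
    rw [← hf.map_act, mem_fixedSubalgebra.1 a.2]
  choose φ hφ using hex
  exact ⟨{
    toFun := φ
    map_one' := hτ.injective (by simp [hφ])
    map_mul' := fun a b => hτ.injective (by simp [hφ])
    map_zero' := hτ.injective (by simp [hφ])
    map_add' := fun a b => hτ.injective (by simp [hφ])
    commutes' := fun c => hτ.injective ((hφ _).trans (hf.map_algebraMap c)) },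
    fun a => (hφ a).symm⟩

end FixedSubalgebra

section Rank

theorem IsGaloisAction.finrank_eq_card {G : Type*} [Group G] [Finite G] {F A : Type*} [Field F]
    [CommRing A] [Algebra F A] {ρ : G →* (A ≃ₐ[F] A)} (h : IsGaloisAction ρ) :
    Module.finrank F A = Nat.card G := by
  have := Fintype.ofFinite G
  have : Nontrivial A := h.injective.nontrivial
  have hb := (isTorsorHom_translationAct ρ).bijective_lift h h.translation
  have hrank := (AlgEquiv.ofBijective _ hb).toLinearEquiv.finrank_eq
  rwa [Module.finrank_baseChange, Module.finrank_pi, ← Nat.card_eq_fintype_card] at hrank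

theorem finrank_eq_sum_residueField (F : Type*) [Field F] {R M : Type*} [CommRing R] [Algebra F R]
    [Module.Finite F R] [IsReduced R] [Fintype (MaximalSpectrum R)] [AddCommGroup M] [Module F M]
    [Module R M] [IsScalarTower F R M] [Module.Finite R M] :
    Module.finrank F M = ∑ m : MaximalSpectrum R, Module.finrank F (R ⧸ m.asIdeal) *
      Module.finrank (R ⧸ m.asIdeal) ((R ⧸ m.asIdeal) ⊗[R] M) := by
  classical
  have := IsArtinianRing.of_finite F R
  have e : M ≃ₗ[R] ((m : MaximalSpectrum R) → (R ⧸ m.asIdeal) ⊗[R] M) :=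
    (TensorProduct.lid R M).symm ≪≫ₗ
      TensorProduct.congr (IsArtinianRing.equivPi R).toLinearEquiv (LinearEquiv.refl R M) ≪≫ₗ
      TensorProduct.piLeft R M _
  have (m : MaximalSpectrum R) : Module.Finite F ((R ⧸ m.asIdeal) ⊗[R] M) :=
    .trans (R ⧸ m.asIdeal) _
  rw [(e.restrictScalars F).finrank_eq, Module.finrank_pi_fintype]
  let _ (m : MaximalSpectrum R) : Field (R ⧸ m.asIdeal) := Ideal.Quotient.field m.asIdeal
  exact Finset.sum_congr rfl fun m _ => (Module.finrank_mul_finrank F (R ⧸ m.asIdeal) _).symm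

theorem IsGaloisAction.exists_not_dvd_finrank_residueField {H : Type*} [Group H] [Finite H]
    {F R A : Type*} [Field F] [CommRing R] [Algebra F R] [Module.Finite F R] [IsReduced R]
    [CommRing A] [Algebra R A] [Algebra F A] [IsScalarTower F R A] {σ : H →* (A ≃ₐ[R] A)}
    (h : IsGaloisAction σ) {l c : ℕ} (hc : Module.finrank F A = c * Nat.card H) (hl : ¬ l ∣ c) :
    ∃ m : Ideal R, m.IsMaximal ∧ ¬ l ∣ Module.finrank F (R ⧸ m) := by
  by_contra! hcon
  have := IsArtinianRing.of_finite F R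
  have := Fintype.ofFinite (MaximalSpectrum R)
  have := h.finite
  let _ (m : MaximalSpectrum R) : Field (R ⧸ m.asIdeal) := Ideal.Quotient.field m.asIdeal
  have hrank (m : MaximalSpectrum R) :
      Module.finrank (R ⧸ m.asIdeal) ((R ⧸ m.asIdeal) ⊗[R] A) = Nat.card H :=
    (h.baseChange _).finrank_eq_card
  rw [finrank_eq_sum_residueField F (R := R)] at hc
  simp only [hrank, ← Finset.sum_mul] at hc
  refine hl (Nat.eq_of_mul_eq_mul_right Nat.card_pos hc ▸ Finset.dvd_sum fun m _ => ?_)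
  exact hcon m.asIdeal m.isMaximal

theorem GaloisAlg.exists_reduction {G H : Type*} [Group G] [Finite G] [Group H] {F : Type u}
    [Field F] (A : GaloisAlg G F) {i : H →* G} (hi : Function.Injective i) {l : ℕ}
    (hl : ¬ l ∣ i.range.index) :
    ∃ (F' : Type u) (_ : Field F') (_ : Algebra F F') (_ : FiniteDimensional F F'),
      ¬ l ∣ Module.finrank F F' ∧ ∃ (A' : GaloisAlg H F') (f : A.carrier →+* A'.carrier),
        IsTorsorHom (A.act.comp i) A'.act f := by
  have := Finite.of_injective i hi
  have hA := A.isGaloisAction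
  have := hA.finite
  have := hA.isReduced
  let R := fixedSubalgebra (A.act.comp i)
  have : IsReduced R := isReduced_of_injective R.val Subtype.val_injective
  have : Module.Finite F R := .of_injective R.val.toLinearMap Subtype.val_injective
  have hAR : IsGaloisAction (fixedAct (A.act.comp i)) := hA.fixedAct_comp hi
  have hrank : Module.finrank F A.carrier = i.range.index * Nat.card H := by
    rw [hA.finrank_eq_card, ← i.range.index_mul_card,
      Nat.card_congr (MonoidHom.ofInjective hi).toEquiv]
  obtain ⟨m, hm, hlm⟩ := hAR.exists_not_dvd_finrank_residueField hrank hl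
  let _ : Field (R ⧸ m) := Ideal.Quotient.field m
  have hA' := hAR.baseChange (R ⧸ m)
  exact ⟨R ⧸ m, inferInstance, inferInstance, inferInstance, hlm,
    ⟨_, _, hA'.injective.nontrivial, hA'.bijective_galoisMap⟩, _,
    (isTorsorHom_includeRight _ (R ⧸ m)).comp (isTorsorHom_fixedAct _)⟩

end Rank

section EssentialDimension

theorem trdeg_restrictScalars_algebraicClosure {k E : Type*} [Field k] [Field E] [Algebra k E]
    (K : IntermediateField k E) :
    Algebra.trdeg k ((algebraicClosure K E).restrictScalars k) = Algebra.trdeg k K := by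
  let L := algebraicClosure K E
  have : FaithfulSMul K L :=
    (faithfulSMul_iff_algebraMap_injective K L).2 (algebraMap K L).injective
  have : Algebra.trdeg K L = 0 := trdeg_eq_zero
  exact (trdeg_add_eq k K (A := L)).symm.trans (by rw [this, add_zero])

variable (k : Type u) [Field k] {F : Type u} [Field F] [Algebra k F]

namespace GaloisAlg

theorem essDimAt_le_essDimAt {G : Type*} [Group G] (A : GaloisAlg G F) (l : ℕ) :
    A.essDimAt k l ≤ _root_.essDimAt k G l :=
  le_sSup ⟨F, inferInstance, inferInstance, A, rfl⟩

variable {l : ℕ} {E : Type u} [Field E] [Algebra k E] [Algebra F E] [IsScalarTower k F E]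
  [FiniteDimensional F E]

theorem essDimAt_le {G : Type*} [Group G] [Finite G] {A : GaloisAlg G F}
    (hl : ¬ l ∣ Module.finrank F E) (K : IntermediateField k E) {B C : Type*} [CommRing B]
    [Algebra K B] [CommRing C] [Algebra E C] {ρ : G →* (B ≃ₐ[K] B)} (hρ : IsGaloisAction ρ)
    {τ : G →* (C ≃ₐ[E] C)} (hτ : IsGaloisAction τ) {f : A.carrier →+* C}
    (hf : IsTorsorHom A.act τ f) {f' : B →+* C} (hf' : IsTorsorHom ρ τ f') :
    A.essDimAt k l ≤ Cardinal.toENat (Algebra.trdeg k K) := by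
  obtain ⟨B', b, hb⟩ := hρ.exists_galoisAlg
  exact sInf_le ⟨E, inferInstance, inferInstance, inferInstance, inferInstance, inferInstance, hl,
    K, B', isoOver_of_isTorsorHom hτ hf (hf'.comp hb), rfl⟩

/-- The invariants of `H` on `B` map to `E`, by elements algebraic over `K`; extending scalars along
this map turns the `G`-torsor over `K` into an `H`-torsor over the algebraic closure of `K` in `E`,
which has the same transcendence degree. -/
theorem essDimAt_le_of_comp {G H : Type*} [Group G] [Finite G] [Group H] {i : H →* G}
    (hi : Function.Injective i) {A : GaloisAlg H F} (hl : ¬ l ∣ Module.finrank F E)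
    (K : IntermediateField k E) {B C : Type*} [CommRing B] [Algebra K B] [CommRing C] [Algebra E C]
    {ρ : G →* (B ≃ₐ[K] B)} (hρ : IsGaloisAction ρ) {τ : H →* (C ≃ₐ[E] C)} (hτ : IsGaloisAction τ)
    {f : A.carrier →+* C} (hf : IsTorsorHom A.act τ f) {f' : B →+* C}
    (hf' : IsTorsorHom (ρ.comp i) τ f') :
    A.essDimAt k l ≤ Cardinal.toENat (Algebra.trdeg k K) := by
  have := Finite.of_injective i hi
  have := hρ.finite
  let R := fixedSubalgebra (ρ.comp i)
  have : Module.Finite K R := .of_injective R.val.toLinearMap Subtype.val_injective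
  obtain ⟨φ, hφ⟩ := hf'.exists_fixedSubalgebra hτ
  let K' := (algebraicClosure K E).restrictScalars k
  let _ : Algebra R E := φ.toRingHom.toAlgebra
  let _ : Algebra R K' := (φ.codRestrict (algebraicClosure K E).toSubalgebra fun a =>
    mem_algebraicClosure_iff.2 ((Algebra.IsIntegral.isIntegral a).map φ).isAlgebraic).toAlgebra
  have : IsScalarTower R K' E := .of_algebraMap_eq fun _ => rfl
  have hR : IsTorsorHom (fixedAct (ρ.comp i)) τ f' := ⟨hφ, hf'.map_act⟩
  obtain ⟨f'', hf''⟩ := hR.exists_baseChange K'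
  rw [← trdeg_restrictScalars_algebraicClosure K]
  exact essDimAt_le k hl K' ((hρ.fixedAct_comp hi).baseChange K') hτ hf hf''

end GaloisAlg

variable {G H : Type*} [Group G] [Finite G] [Group H] {i : H →* G} {l : ℕ}

theorem essDimAt_le_of_injective (hi : Function.Injective i) (l : ℕ) :
    essDimAt k H l ≤ essDimAt k G l := by
  have := Finite.of_injective i hi
  refine sSup_le ?_
  rintro _ ⟨F, _, _, A, rfl⟩
  obtain ⟨I, e, he⟩ := (A.isGaloisAction.induced hi).exists_galoisAlg
  refine le_trans (le_sInf ?_) (I.essDimAt_le_essDimAt k l)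
  rintro _ ⟨E, _, _, _, _, _, hl, K, B, hiso, rfl⟩
  obtain ⟨f, hf⟩ := GaloisAlg.exists_hom_of_isoOver hiso
  have hA := isTorsorHom_includeRight A.act E
  have hev := hA.comp ((isTorsorHom_eval_one i A.act).comp (he.restrict i))
  exact GaloisAlg.essDimAt_le_of_comp k hi hl K B.isGaloisAction (A.isGaloisAction.baseChange E)
    hA (hev.isTorsorHom_lift.comp (hf.restrict i))

theorem essDimAt_le_of_not_dvd_index (hi : Function.Injective i) (hl : l.Prime)
    (hindex : ¬ l ∣ i.range.index) : essDimAt k G l ≤ essDimAt k H l := by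
  have := Finite.of_injective i hi
  refine sSup_le ?_
  rintro _ ⟨F, _, _, A, rfl⟩
  obtain ⟨F', _, _, _, hlF, A', r, hr⟩ := A.exists_reduction hi hindex
  let _ : Algebra k F' := ((algebraMap F F').comp (algebraMap k F)).toAlgebra
  have : IsScalarTower k F F' := .of_algebraMap_eq fun _ => rfl
  refine le_trans (le_sInf ?_) (A'.essDimAt_le_essDimAt k l)
  rintro _ ⟨E, _, _, _, _, _, hlE, K, B, hiso, rfl⟩
  let _ : Algebra F E := ((algebraMap F' E).comp (algebraMap F F')).toAlgebra
  have : IsScalarTower F F' E := .of_algebraMap_eq fun _ => rfl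
  have : IsScalarTower k F E := .of_algebraMap_eq fun c => IsScalarTower.algebraMap_apply k F' E c
  have : FiniteDimensional F E := .trans F F' E
  obtain ⟨f, hf⟩ := GaloisAlg.exists_hom_of_isoOver hiso
  obtain ⟨a, ha⟩ := ((isTorsorHom_includeRight A'.act E).comp hr).exists_induced
  obtain ⟨b, hb⟩ := (hf.comp (isTorsorHom_eval_one i B.act)).exists_induced
  have hB := B.isGaloisAction.induced hi
  have hA' := (A'.isGaloisAction.baseChange E).induced hi
  have hlFE : ¬ l ∣ Module.finrank F E := by
    rw [← Module.finrank_mul_finrank F F' E, hl.dvd_mul]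
    exact not_or.2 ⟨hlF, hlE⟩
  exact GaloisAlg.essDimAt_le k hlFE K hB hA' ha hb

theorem essDimAt_eq_of_injective (hi : Function.Injective i) (hl : l.Prime)
    (hindex : ¬ l ∣ i.range.index) : essDimAt k H l = essDimAt k G l :=
  (essDimAt_le_of_injective k hi l).antisymm (essDimAt_le_of_not_dvd_index k hi hl hindex)

/-- A Sylow `l`-subgroup embeds into the quotient as a subgroup of index prime to `l`. -/
theorem essDimAt_quotient_eq (Z : Subgroup G) [Z.Normal] (hl : l.Prime) (hZ : ¬ l ∣ Nat.card Z) :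
    essDimAt k (G ⧸ Z) l = essDimAt k G l := by
  have : Fact l.Prime := ⟨hl⟩
  obtain ⟨P⟩ : Nonempty (Sylow l G) := inferInstance
  have hcop : (Nat.card P).Coprime (Nat.card Z) := by
    obtain ⟨m, hm⟩ := P.isPGroup'.exists_card_eq
    exact hm ▸ (hl.coprime_iff_not_dvd.2 hZ).pow_left m
  let j : P →* G ⧸ Z := (QuotientGroup.mk' Z).comp (P : Subgroup G).subtype
  have hj : Function.Injective j := (injective_iff_map_eq_one j).2 fun x hx => by
    have hxZ : (x : G) ∈ Z := (QuotientGroup.eq_one_iff _).1 hx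
    exact Subtype.ext (Subgroup.disjoint_def.1 (Subgroup.disjoint_of_coprime_natCard hcop) x.2 hxZ)
  have hindex : j.range.index ∣ (P : Subgroup G).index := by
    rw [MonoidHom.range_comp, Subgroup.range_subtype]
    exact Subgroup.index_map_dvd _ (QuotientGroup.mk'_surjective Z)
  rw [← essDimAt_eq_of_injective k hj hl fun h => P.not_dvd_index (h.trans hindex)]
  refine essDimAt_eq_of_injective k (P : Subgroup G).subtype_injective hl ?_
  rw [Subgroup.range_subtype]
  exact P.not_dvd_index

end EssentialDimension

section SymplecticCounting

variable {𝔽 V : Type*} [Field 𝔽] [AddCommGroup V] [Module 𝔽 V] {ω : LinearMap.BilinForm 𝔽 V}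
  {j : ℕ} {t : Fin j → V × V}

/-- A system of `j` mutually orthogonal hyperbolic pairs. -/
def IsHyperbolic (ω : LinearMap.BilinForm 𝔽 V) (t : Fin j → V × V) : Prop :=
  (∀ a b, ω (t a).1 (t b).1 = 0) ∧ (∀ a b, ω (t a).2 (t b).2 = 0) ∧
    ∀ a b, ω (t a).1 (t b).2 = if a = b then 1 else 0

/-- The pairings of a vector with the members of a system of pairs. -/
def pairsPairing (ω : LinearMap.BilinForm 𝔽 V) (t : Fin j → V × V) : V →ₗ[𝔽] Fin j → 𝔽 × 𝔽 :=
  LinearMap.pi fun a => (ω (t a).1).prod (ω (t a).2)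

/-- The orthogonal complement of a system of pairs. -/
def pairsOrthogonal (ω : LinearMap.BilinForm 𝔽 V) (t : Fin j → V × V) : Submodule 𝔽 V :=
  LinearMap.ker (pairsPairing ω t)

theorem mem_pairsOrthogonal {v : V} :
    v ∈ pairsOrthogonal ω t ↔ ∀ a, ω (t a).1 v = 0 ∧ ω (t a).2 v = 0 := by
  simp [pairsOrthogonal, pairsPairing, funext_iff]

theorem isHyperbolic_cons (hω : ω.IsAlt) (p : V × V) (t : Fin j → V × V) :
    IsHyperbolic ω (Fin.cons p t : Fin (j + 1) → V × V) ↔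
      IsHyperbolic ω t ∧ p.1 ∈ pairsOrthogonal ω t ∧ p.2 ∈ pairsOrthogonal ω t ∧ ω p.1 p.2 = 1 := by
  simp only [IsHyperbolic, Fin.forall_fin_succ, Fin.cons_zero, Fin.cons_succ, hω.self_eq_zero,
    mem_pairsOrthogonal, Fin.succ_inj, forall_and, (Fin.succ_ne_zero _).symm, Fin.succ_ne_zero,
    if_true, if_false, hω.isRefl.eq_iff (x := p.1), hω.isRefl.eq_iff (x := p.2)]
  tauto

namespace IsHyperbolic

theorem pairsPairing_sum (hω : ω.IsAlt) (ht : IsHyperbolic ω t) (c : Fin j → 𝔽 × 𝔽) :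
    pairsPairing ω t (∑ a, ((c a).1 • (t a).2 - (c a).2 • (t a).1)) = c := by
  obtain ⟨h11, h22, h12⟩ := ht
  have h21 (a b) : ω (t a).2 (t b).1 = -if a = b then 1 else 0 := by
    rw [← hω.neg_eq, h12]
    simp only [eq_comm]
  ext b <;> simp [pairsPairing, h11, h22, h12, h21]

theorem finrank_pairsOrthogonal [Module.Finite 𝔽 V] (hω : ω.IsAlt) (ht : IsHyperbolic ω t) :
    Module.finrank 𝔽 (pairsOrthogonal ω t) = Module.finrank 𝔽 V - 2 * j := by
  have hsurj : Function.Surjective (pairsPairing ω t) := fun c => ⟨_, ht.pairsPairing_sum hω c⟩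
  have hrank := (pairsPairing ω t).finrank_range_add_finrank_ker
  rw [LinearMap.range_eq_top.2 hsurj, finrank_top, Module.finrank_pi_fintype] at hrank
  simp only [Module.finrank_prod, Module.finrank_self, Finset.sum_const, Finset.card_univ,
    Fintype.card_fin, smul_eq_mul] at hrank
  rw [pairsOrthogonal]
  omega

theorem exists_apply_ne_zero (hω : ω.IsAlt) (hnd : ω.SeparatingLeft) (ht : IsHyperbolic ω t)
    {e : V} (he : e ∈ pairsOrthogonal ω t) (he0 : e ≠ 0) :
    ∃ f ∈ pairsOrthogonal ω t, ω e f ≠ 0 := by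
  by_contra! hcon
  refine he0 (hnd e fun v => ?_)
  have he' (a) : ω e (t a).1 = 0 ∧ ω e (t a).2 = 0 :=
    (mem_pairsOrthogonal.1 he a).imp (hω.isRefl _ _) (hω.isRefl _ _)
  let c := pairsPairing ω t v
  have hv := hcon (v - ∑ a, ((c a).1 • (t a).2 - (c a).2 • (t a).1)) <| by
    rw [pairsOrthogonal, LinearMap.mem_ker, map_sub, ht.pairsPairing_sum hω, sub_self]
  simpa [he'] using hv

end IsHyperbolic

theorem card_fiber_linearMap {W : Type*} [AddCommGroup W] [Module 𝔽 W] [Module.Finite 𝔽 W]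
    {φ : W →ₗ[𝔽] 𝔽} (hφ : φ ≠ 0) (c : 𝔽) :
    Nat.card {w // φ w = c} = Nat.card 𝔽 ^ (Module.finrank 𝔽 W - 1) := by
  have hsurj : Function.Surjective φ := LinearMap.surjective hφ
  obtain ⟨w₀, rfl⟩ := hsurj c
  have e : {w // φ w = φ w₀} ≃ LinearMap.ker φ :=
    (Equiv.subRight w₀).subtypeEquiv fun w => by simp [sub_eq_zero]
  have hrank := φ.finrank_range_add_finrank_ker
  rw [LinearMap.range_eq_top.2 hsurj, finrank_top, Module.finrank_self] at hrank
  rw [Nat.card_congr e, Module.natCard_eq_pow_finrank (K := 𝔽), ← hrank, Nat.add_sub_cancel_left]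

theorem card_apply_eq_one [Finite 𝔽] {W : Type*} [AddCommGroup W] [Module 𝔽 W] [Module.Finite 𝔽 W]
    {ω : LinearMap.BilinForm 𝔽 W} (hω : ω.SeparatingLeft) :
    Nat.card {p : W × W // ω p.1 p.2 = 1} =
      (Nat.card 𝔽 ^ Module.finrank 𝔽 W - 1) * Nat.card 𝔽 ^ (Module.finrank 𝔽 W - 1) := by
  classical
  have : Finite W := Module.finite_of_finite 𝔽
  have := Fintype.ofFinite W
  have hzero : Nat.card {f : W // ω 0 f = 1} = 0 := by simp
  have hne (e) (he : e ∈ Finset.univ.erase (0 : W)) :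
      Nat.card {f // ω e f = 1} = Nat.card 𝔽 ^ (Module.finrank 𝔽 W - 1) :=
    card_fiber_linearMap (fun h => Finset.ne_of_mem_erase he (hω e (LinearMap.congr_fun h))) 1
  rw [Nat.card_congr (Equiv.subtypeProdEquivSigmaSubtype fun e f => ω e f = 1), Nat.card_sigma,
    ← Finset.add_sum_erase _ _ (Finset.mem_univ 0), hzero, zero_add, Finset.sum_congr rfl hne,
    Finset.sum_const, Finset.card_erase_of_mem (Finset.mem_univ _), Finset.card_univ,
    ← Nat.card_eq_fintype_card, Module.natCard_eq_pow_finrank (K := 𝔽), smul_eq_mul]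

/-- A hyperbolic system of `j + 1` pairs is one of `j` pairs and a hyperbolic pair orthogonal to
it. -/
def isHyperbolicSuccEquiv (hω : ω.IsAlt) (j : ℕ) :
    {t : Fin (j + 1) → V × V // IsHyperbolic ω t} ≃
      Σ t : {t : Fin j → V × V // IsHyperbolic ω t},
        {p : pairsOrthogonal ω t.1 × pairsOrthogonal ω t.1 // ω p.1 p.2 = 1} where
  toFun t :=
    have h := (isHyperbolic_cons hω (t.1 0) (Fin.tail t.1)).1 (by simpa using t.2)
    ⟨⟨Fin.tail t.1, h.1⟩, (⟨(t.1 0).1, h.2.1⟩, ⟨(t.1 0).2, h.2.2.1⟩), h.2.2.2⟩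
  invFun s := ⟨Fin.cons (s.2.1.1.1, s.2.1.2.1) s.1.1,
    (isHyperbolic_cons hω _ _).2 ⟨s.1.2, s.2.1.1.2, s.2.1.2.2, s.2.2⟩⟩
  left_inv t := Subtype.ext (Fin.cons_self_tail t.1)
  right_inv _ := rfl

theorem card_isHyperbolic [Finite 𝔽] [Module.Finite 𝔽 V] (hω : ω.IsAlt) (hnd : ω.SeparatingLeft)
    (j : ℕ) : Nat.card {t : Fin j → V × V // IsHyperbolic ω t} =
      ∏ i ∈ Finset.range j, (Nat.card 𝔽 ^ (Module.finrank 𝔽 V - 2 * i) - 1) *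
        Nat.card 𝔽 ^ (Module.finrank 𝔽 V - 2 * i - 1) := by
  have : Finite V := Module.finite_of_finite 𝔽
  induction j with
  | zero => simp [IsHyperbolic]
  | succ j ih =>
    have := Fintype.ofFinite {t : Fin j → V × V // IsHyperbolic ω t}
    have hcard (t : {t : Fin j → V × V // IsHyperbolic ω t}) :
        Nat.card {p : pairsOrthogonal ω t.1 × pairsOrthogonal ω t.1 // ω p.1 p.2 = 1} =
        (Nat.card 𝔽 ^ (Module.finrank 𝔽 V - 2 * j) - 1) *
          Nat.card 𝔽 ^ (Module.finrank 𝔽 V - 2 * j - 1) := by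
      have hsep : (ω.restrict (pairsOrthogonal ω t.1)).SeparatingLeft := fun e he => by
        by_contra he0
        obtain ⟨f, hf, hef⟩ := t.2.exists_apply_ne_zero hω hnd e.2 (by simpa using he0)
        exact hef (he ⟨f, hf⟩)
      rw [← t.2.finrank_pairsOrthogonal hω]
      exact card_apply_eq_one hsep
    rw [Nat.card_congr (isHyperbolicSuccEquiv hω j), Nat.card_sigma, Finset.prod_range_succ, ← ih,
      Finset.sum_congr rfl fun t _ => hcard t, Finset.sum_const, Finset.card_univ,
      ← Nat.card_eq_fintype_card, smul_eq_mul]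

end SymplecticCounting

section SymplecticForm

variable {ι R : Type*} [Fintype ι] [DecidableEq ι] [CommRing R]

variable (ι R) in
/-- The standard symplectic form on `R ^ (ι ⊕ ι)`, with Gram matrix `Matrix.J`. -/
noncomputable def symplecticForm : LinearMap.BilinForm R (ι ⊕ ι → R) :=
  Matrix.toBilin' (Matrix.J ι R)

theorem symplecticForm_apply (x y : ι ⊕ ι → R) :
    symplecticForm ι R x y =
      ∑ i, (x (Sum.inr i) * y (Sum.inl i) - x (Sum.inl i) * y (Sum.inr i)) := by
  simp [symplecticForm, Matrix.toBilin'_apply', Matrix.J, dotProduct, Matrix.mulVec,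
    Fintype.sum_sum_type, Matrix.one_apply, Finset.sum_add_distrib, sub_eq_neg_add]

theorem symplecticForm_isAlt : (symplecticForm ι R).IsAlt := fun x => by
  rw [symplecticForm_apply]
  exact Finset.sum_eq_zero fun i _ => by ring

theorem symplecticForm_separatingLeft : (symplecticForm ι R).SeparatingLeft := by
  intro x hx
  ext (i | i)
  · simpa [symplecticForm_apply, Pi.single_apply] using hx (Pi.single (Sum.inr i) 1)
  · simpa [symplecticForm_apply, Pi.single_apply] using hx (Pi.single (Sum.inl i) 1)

theorem mem_symplecticGroup_iff_symplecticForm {A : Matrix (ι ⊕ ι) (ι ⊕ ι) R} :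
    A ∈ Matrix.symplecticGroup ι R ↔
      ∀ i j, symplecticForm ι R (A i) (A j) = Matrix.J ι R i j := by
  rw [SymplecticGroup.mem_iff, ← Matrix.ext_iff]
  refine forall₂_congr fun i j => ?_
  rw [symplecticForm, Matrix.toBilin'_apply', Matrix.mul_assoc, Matrix.mul_apply']
  rfl

end SymplecticForm

section Orders

variable {n : ℕ} {𝔽 : Type*} [Field 𝔽]

theorem mem_symplecticGroup_iff_isHyperbolic {A : Matrix (Fin n ⊕ Fin n) (Fin n ⊕ Fin n) 𝔽} :
    A ∈ Matrix.symplecticGroup (Fin n) 𝔽 ↔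
      IsHyperbolic (symplecticForm (Fin n) 𝔽) fun a => (A (Sum.inr a), A (Sum.inl a)) := by
  rw [mem_symplecticGroup_iff_symplecticForm]
  constructor
  · intro h
    exact ⟨fun a b => by simp [h, Matrix.J], fun a b => by simp [h, Matrix.J],
      fun a b => by simp [h, Matrix.J, Matrix.one_apply]⟩
  · rintro ⟨h1, h2, h3⟩ (i | i) (j | j)
    · simp [h2, Matrix.J]
    · rw [← symplecticForm_isAlt.neg_eq, h3]
      simp [Matrix.J, Matrix.one_apply, eq_comm]
    · simp [h3, Matrix.J, Matrix.one_apply]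
    · simp [h1, Matrix.J]

variable (n 𝔽) in
/-- A symplectic matrix, seen as the hyperbolic system formed by its rows. -/
def symplecticGroupEquivIsHyperbolic : Matrix.symplecticGroup (Fin n) 𝔽 ≃
    {t : Fin n → (Fin n ⊕ Fin n → 𝔽) × (Fin n ⊕ Fin n → 𝔽) //
      IsHyperbolic (symplecticForm (Fin n) 𝔽) t} where
  toFun A := ⟨_, mem_symplecticGroup_iff_isHyperbolic.1 A.2⟩
  invFun t := ⟨fun i => Sum.elim (fun a => (t.1 a).2) (fun a => (t.1 a).1) i,
    mem_symplecticGroup_iff_isHyperbolic.2 t.2⟩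
  left_inv A := by
    ext (i | i) j <;> rfl
  right_inv _ := rfl

theorem card_symplecticGroup [Finite 𝔽] : Nat.card (Matrix.symplecticGroup (Fin n) 𝔽) =
    Nat.card 𝔽 ^ n ^ 2 * ∏ i ∈ Finset.range n, (Nat.card 𝔽 ^ (2 * (i + 1)) - 1) := by
  have hsum : ∑ i ∈ Finset.range n, (2 * i + 1) = n ^ 2 := by
    induction n with
    | zero => rfl
    | succ n ih => rw [Finset.sum_range_succ, ih]; ring
  rw [Nat.card_congr (symplecticGroupEquivIsHyperbolic n 𝔽),
    card_isHyperbolic symplecticForm_isAlt symplecticForm_separatingLeft, ← hsum,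
    ← Finset.prod_pow_eq_pow_sum, ← Finset.prod_mul_distrib, ← Finset.prod_range_reflect]
  refine Finset.prod_congr rfl fun i hi => ?_
  have hi := Finset.mem_range.1 hi
  rw [Module.finrank_fintype_fun_eq_card, Fintype.card_sum, Fintype.card_fin, mul_comm]
  congr 2 <;> [skip; congr 1] <;> omega

theorem card_generalLinearGroup [Finite 𝔽] :
    Nat.card (Matrix.GeneralLinearGroup (Fin n) 𝔽) =
      Nat.card 𝔽 ^ n.choose 2 * ∏ i ∈ Finset.range n, (Nat.card 𝔽 ^ (i + 1) - 1) := by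
  have := Fintype.ofFinite 𝔽
  rw [Matrix.card_GL_field, ← Finset.prod_range_reflect (fun i => _ - 1), Nat.choose_two_right,
    ← Finset.sum_range_id, ← Finset.prod_pow_eq_pow_sum, ← Finset.prod_mul_distrib,
    Nat.card_eq_fintype_card, ← Fin.prod_univ_eq_prod_range (fun i => _ ^ i * _)]
  refine Finset.prod_congr rfl fun i _ => ?_
  rw [Nat.mul_sub, mul_one, ← pow_add]
  congr 2
  omega

end Orders

section Embeddings

variable (n : ℕ) (R : Type*) [CommRing R]

/-- The inclusion of the symplectic group in the general linear group. -/
noncomputable def symplecticToGL :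
    Matrix.symplecticGroup (Fin n) R →* Matrix.GeneralLinearGroup (Fin (2 * n)) R :=
  MonoidHom.toHomUnits <|
    (Matrix.reindexAlgEquiv R R (finSumFinEquiv.trans (finCongr (two_mul n).symm))
      : Matrix (Fin n ⊕ Fin n) (Fin n ⊕ Fin n) R →* _).comp
      (Matrix.symplecticGroup (Fin n) R).subtype

theorem symplecticToGL_injective : Function.Injective (symplecticToGL n R) := fun _ _ h =>
  Subtype.ext ((Matrix.reindexAlgEquiv R R _).injective (congrArg Units.val h))

variable (ι : Type*) [Fintype ι] [DecidableEq ι]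

/-- The Levi subgroup `GL_n` of the symplectic group, stabilizing a pair of transversal
Lagrangians. -/
def glToSymplectic : Matrix.GeneralLinearGroup ι R →* Matrix.symplecticGroup ι R where
  toFun A := ⟨Matrix.fromBlocks A.1 0 0 (A⁻¹).1.transpose, by
    rw [SymplecticGroup.fromBlocks_mem_iff]
    simp [← Matrix.transpose_mul]⟩
  map_one' := by ext1; simp
  map_mul' A B := by
    ext1
    simp [Matrix.fromBlocks_multiply, Matrix.transpose_mul]

theorem glToSymplectic_injective : Function.Injective (glToSymplectic R ι) := fun A B h =>
  Units.ext <| by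
    simpa [glToSymplectic] using congrArg (fun M => M.1.toBlocks₁₁) h

end Embeddings

section Indices

theorem index_range_mul_card {G H : Type*} [Group G] [Group H] {i : H →* G}
    (hi : Function.Injective i) : i.range.index * Nat.card H = Nat.card G := by
  rw [Nat.card_congr (MonoidHom.ofInjective hi).toEquiv, Subgroup.index_mul_card]

theorem prod_range_two_mul {M : Type*} [CommMonoid M] (f : ℕ → M) (n : ℕ) :
    ∏ i ∈ Finset.range (2 * n), f i =
      (∏ i ∈ Finset.range n, f (2 * i)) * ∏ i ∈ Finset.range n, f (2 * i + 1) := by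
  induction n with
  | zero => simp
  | succ n ih =>
    rw [mul_add_one, Finset.prod_range_succ, Finset.prod_range_succ, ih, Finset.prod_range_succ,
      Finset.prod_range_succ, mul_assoc, mul_mul_mul_comm]

theorem choose_two_two_mul (n : ℕ) : (2 * n).choose 2 = n ^ 2 + 2 * n.choose 2 := by
  induction n with
  | zero => rfl
  | succ n ih =>
    simp only [mul_add_one, Nat.choose_succ_succ' _ 1, Nat.choose_one_right, ih]
    ring

theorem choose_two_add_choose_two_succ (n : ℕ) : n.choose 2 + (n + 1).choose 2 = n ^ 2 := by
  induction n with
  | zero => rfl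
  | succ n ih =>
    simp only [Nat.choose_succ_succ' _ 1, Nat.choose_one_right] at ih ⊢
    linarith

variable (n : ℕ) (𝔽 : Type*) [Field 𝔽] [Finite 𝔽]

theorem index_range_symplecticToGL : (symplecticToGL n 𝔽).range.index =
    Nat.card 𝔽 ^ (2 * n.choose 2) * ∏ i ∈ Finset.range n, (Nat.card 𝔽 ^ (2 * i + 1) - 1) := by
  have hpos : 0 < Nat.card (Matrix.symplecticGroup (Fin n) 𝔽) := Nat.card_pos
  refine Nat.eq_of_mul_eq_mul_right hpos ?_
  rw [index_range_mul_card (symplecticToGL_injective n 𝔽), card_generalLinearGroup,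
    card_symplecticGroup, prod_range_two_mul, choose_two_two_mul, pow_add]
  simp only [mul_add_one]
  ring

theorem index_range_glToSymplectic : (glToSymplectic 𝔽 (Fin n)).range.index =
    Nat.card 𝔽 ^ (n + 1).choose 2 * ∏ i ∈ Finset.range n, (Nat.card 𝔽 ^ (i + 1) + 1) := by
  have hpos : 0 < Nat.card (Matrix.GeneralLinearGroup (Fin n) 𝔽) := Nat.card_pos
  have hfac (i : ℕ) : Nat.card 𝔽 ^ (2 * (i + 1)) - 1 =
      (Nat.card 𝔽 ^ (i + 1) + 1) * (Nat.card 𝔽 ^ (i + 1) - 1) := by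
    rw [mul_comm 2, pow_mul]
    exact Nat.sq_sub_sq _ 1
  refine Nat.eq_of_mul_eq_mul_right hpos ?_
  rw [index_range_mul_card (glToSymplectic_injective 𝔽 (Fin n)), card_symplecticGroup,
    card_generalLinearGroup, ← choose_two_add_choose_two_succ, pow_add,
    Finset.prod_congr rfl fun i _ => hfac i, Finset.prod_mul_distrib]
  ring

end Indices

section Center

variable {ι R : Type*} [Fintype ι] [CommRing R]

theorem isDiag_of_commute_isSymm {a : Matrix ι ι R}
    (ha : ∀ S : Matrix ι ι R, S.IsSymm → Commute S a) : a.IsDiag := by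
  classical
  intro i j hij
  have hS : (Matrix.single i i (1 : R)).IsSymm := by simp [Matrix.IsSymm]
  exact Matrix.row_eq_zero_of_commute_single (ha _ hS) hij.symm

variable [DecidableEq ι]

theorem fromBlocks_one_zero_one_mem_symplecticGroup {S : Matrix ι ι R} (hS : S.IsSymm) :
    Matrix.fromBlocks 1 S 0 1 ∈ Matrix.symplecticGroup ι R :=
  SymplecticGroup.fromBlocks_mem_iff.2 (by simp [hS.eq])

theorem exists_eq_fromBlocks_of_mem_center_symplecticGroup {z : Matrix.symplecticGroup ι R}
    (hz : z ∈ Subgroup.center (Matrix.symplecticGroup ι R)) :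
    ∃ a : Matrix ι ι R, a.IsDiag ∧ z.1 = Matrix.fromBlocks a 0 0 a := by
  rw [Subgroup.mem_center_iff] at hz
  obtain ⟨a, b, c, d, hzb⟩ : ∃ a b c d, z.1 = Matrix.fromBlocks a b c d :=
    ⟨_, _, _, _, (Matrix.fromBlocks_toBlocks z.1).symm⟩
  have hJ : -c = b ∧ d = a := by
    have h := congrArg Subtype.val (hz (SymplecticGroup.symJ ι R))
    simp only [Submonoid.coe_mul, SymplecticGroup.coe_J, Matrix.J, hzb, Matrix.fromBlocks_multiply,
      Matrix.fromBlocks_inj] at h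
    exact ⟨by simpa using h.1, by simpa using h.2.1⟩
  have hS (S : Matrix ι ι R) (hS : S.IsSymm) : S * c = 0 ∧ S * d = a * S := by
    have h := congrArg Subtype.val (hz ⟨_, fromBlocks_one_zero_one_mem_symplecticGroup hS⟩)
    simp only [Submonoid.coe_mul, hzb, Matrix.fromBlocks_multiply, Matrix.fromBlocks_inj] at h
    simpa [add_comm b] using And.intro h.1 h.2.1
  have hc : c = 0 := by simpa using (hS 1 Matrix.isSymm_one).1
  have hb : b = 0 := by simpa [hc] using hJ.1.symm
  rw [hJ.2] at hS
  refine ⟨a, isDiag_of_commute_isSymm fun S h => (hS S h).2, ?_⟩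
  rw [hzb, hc, hb, hJ.2]

theorem sq_eq_one_of_mem_center_symplecticGroup {z : Matrix.symplecticGroup ι R}
    (hz : z ∈ Subgroup.center (Matrix.symplecticGroup ι R)) : z ^ 2 = 1 := by
  obtain ⟨a, ha, hza⟩ := exists_eq_fromBlocks_of_mem_center_symplecticGroup hz
  have haa : a * a = 1 := by
    have h := z.2
    rw [hza, SymplecticGroup.fromBlocks_mem_iff] at h
    simpa [ha.isSymm.eq] using h.2.2
  ext1
  rw [SubmonoidClass.coe_pow, pow_two, hza, Matrix.fromBlocks_multiply]
  simp [haa]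

theorem not_dvd_card_center_symplecticGroup {𝔽 : Type*} [Field 𝔽] [Finite 𝔽] {l : ℕ} (hl : l.Prime)
    (hl2 : l ≠ 2) : ¬ l ∣ Nat.card (Subgroup.center (Matrix.symplecticGroup ι 𝔽)) := by
  intro h
  have : Fact l.Prime := ⟨hl⟩
  obtain ⟨z, hz⟩ := exists_prime_orderOf_dvd_card' l h
  have hdvd : l ∣ 2 := hz ▸ orderOf_dvd_of_pow_eq_one
    (Subtype.ext (sq_eq_one_of_mem_center_symplecticGroup z.2))
  exact hl2 ((Nat.prime_dvd_prime_iff_eq hl Nat.prime_two).1 hdvd)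

end Center

section Arithmetic

variable {l q : ℕ}

theorem dvd_pow_sub_one_iff_orderOf_dvd (hq : 0 < q) (m : ℕ) :
    l ∣ q ^ m - 1 ↔ orderOf (q : ZMod l) ∣ m := by
  rw [← ZMod.natCast_eq_zero_iff, Nat.cast_sub (Nat.one_le_pow _ _ hq), sub_eq_zero,
    orderOf_dvd_iff_pow_eq_one, Nat.cast_pow, Nat.cast_one]

theorem orderOf_eq_of_isLeast {d : ℕ} (hq : 0 < q)
    (hd : IsLeast {m : ℕ | 0 < m ∧ l ∣ q ^ m - 1} d) : orderOf (q : ZMod l) = d := by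
  simp only [dvd_pow_sub_one_iff_orderOf_dvd hq] at hd
  exact le_antisymm (Nat.le_of_dvd hd.1.1 hd.1.2)
    (hd.2 ⟨Nat.pos_of_dvd_of_pos hd.1.2 hd.1.1, dvd_rfl⟩)

theorem not_dvd_pow_sub_one_of_even_orderOf (hq : 0 < q) (heven : Even (orderOf (q : ZMod l)))
    {m : ℕ} (hm : Odd m) : ¬ l ∣ q ^ m - 1 := by
  rw [dvd_pow_sub_one_iff_orderOf_dvd hq]
  exact fun h => Nat.not_even_iff_odd.2 hm (heven.trans_dvd h)

theorem not_dvd_pow_add_one_of_odd_orderOf (hl : ¬ l ∣ 2) (hodd : Odd (orderOf (q : ZMod l)))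
    (m : ℕ) : ¬ l ∣ q ^ m + 1 := by
  rw [← ZMod.natCast_eq_zero_iff] at hl ⊢
  push_cast
  intro h
  have hsq : (q : ZMod l) ^ (2 * m) = 1 := by
    rw [mul_comm, pow_mul, eq_neg_of_add_eq_zero_left h, neg_one_sq]
  have hone : (q : ZMod l) ^ m = 1 := orderOf_dvd_iff_pow_eq_one.1 <|
    (Nat.coprime_two_right.2 hodd).dvd_of_dvd_mul_left (orderOf_dvd_of_pow_eq_one hsq)
  rw [hone, one_add_one_eq_two] at h
  exact hl h

variable (n : ℕ) {𝔽 : Type*} [Field 𝔽] [Finite 𝔽]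

theorem not_dvd_index_range_symplecticToGL (hl : l.Prime) (hlq : ¬ l ∣ Nat.card 𝔽)
    (heven : Even (orderOf (Nat.card 𝔽 : ZMod l))) : ¬ l ∣ (symplecticToGL n 𝔽).range.index := by
  rw [index_range_symplecticToGL, hl.dvd_mul, hl.prime.dvd_finsetProd_iff, not_or]
  refine ⟨fun h => hlq (hl.dvd_of_dvd_pow h), ?_⟩
  rintro ⟨i, -, hi⟩
  exact not_dvd_pow_sub_one_of_even_orderOf Nat.card_pos heven (odd_two_mul_add_one i) hi

theorem not_dvd_index_range_glToSymplectic (hl : l.Prime) (hl2 : l ≠ 2)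
    (hodd : Odd (orderOf (Nat.card 𝔽 : ZMod l))) :
    ¬ l ∣ (glToSymplectic 𝔽 (Fin n)).range.index := by
  have : Fact l.Prime := ⟨hl⟩
  have hlq : ¬ l ∣ Nat.card 𝔽 := fun h => by
    simp [(ZMod.natCast_eq_zero_iff _ _).2 h] at hodd
  have hl2' : ¬ l ∣ 2 := fun h => hl2 ((Nat.prime_dvd_prime_iff_eq hl Nat.prime_two).1 h)
  rw [index_range_glToSymplectic, hl.dvd_mul, hl.prime.dvd_finsetProd_iff, not_or]
  refine ⟨fun h => hlq (hl.dvd_of_dvd_pow h), ?_⟩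
  rintro ⟨i, -, hi⟩
  exact not_dvd_pow_add_one_of_odd_orderOf hl2' hodd (i + 1) hi

end Arithmetic

theorem theorem7p1_general (l n d : ℕ) (hl : l.Prime) (hl2 : l ≠ 2) (𝔽 : Type v) [Field 𝔽]
    [Finite 𝔽] (k : Type u) [Field k]
    (hd : IsLeast {m : ℕ | 0 < m ∧ l ∣ Nat.card 𝔽 ^ m - 1} d) :
    essDimAt k (PSp n 𝔽) l = essDimAt k (Sp n 𝔽) l ∧
      essDimAt k (Sp n 𝔽) l =
        if Even d then essDimAt k (Matrix.GeneralLinearGroup (Fin (2 * n)) 𝔽) l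
        else essDimAt k (Matrix.GeneralLinearGroup (Fin n) 𝔽) l := by
  have hlq : ¬ l ∣ Nat.card 𝔽 := fun h => hl.one_lt.ne' <| Nat.dvd_one.1 <| by
    have hdvd : l ∣ Nat.card 𝔽 ^ d := h.trans (dvd_pow_self _ hd.1.1.ne')
    exact (Nat.dvd_sub_iff_right (Nat.one_le_pow _ _ Nat.card_pos) hdvd).1 hd.1.2
  refine ⟨essDimAt_quotient_eq k _ hl (not_dvd_card_center_symplecticGroup hl hl2), ?_⟩
  rw [← orderOf_eq_of_isLeast Nat.card_pos hd]
  split_ifs with h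
  · exact essDimAt_eq_of_injective k (symplecticToGL_injective n 𝔽) hl
      (not_dvd_index_range_symplecticToGL n hl hlq h)
  · exact (essDimAt_eq_of_injective k (glToSymplectic_injective 𝔽 (Fin n)) hl
      (not_dvd_index_range_glToSymplectic n hl hl2 (Nat.not_even_iff_odd.1 h))).symm

theorem theorem7p1 (p r l n d : ℕ) (hp : p.Prime) (hl : l.Prime) (hl2 : l ≠ 2) (hlp : l ≠ p)
    (𝔽 : Type v) [Field 𝔽] [Finite 𝔽] (hq : Nat.card 𝔽 = p ^ r)
    (k : Type u) [Field k] (hk : ringChar k ≠ l)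
    (hd : IsLeast {m : ℕ | 0 < m ∧ l ∣ (p ^ r) ^ m - 1} d) :
    essDimAt k (PSp n 𝔽) l = essDimAt k (Sp n 𝔽) l ∧
      essDimAt k (Sp n 𝔽) l =
        if Even d then essDimAt k (Matrix.GeneralLinearGroup (Fin (2 * n)) 𝔽) l
        else essDimAt k (Matrix.GeneralLinearGroup (Fin n) 𝔽) l :=
  theorem7p1_general l n d hl hl2 𝔽 k (hq.symm ▸ hd)
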